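/- For positive integers $n, r$ write $[n]=\{1,\dots,n\}$. For $A\subseteq[n]$, an $r$-coloring of $A$ is a map $c\colon A\to[r]$; a 3-term arithmetic progression (3-AP) of $A$ is a sequence $a,\,a+d,\,a+2d$ of elements of $A$ with an integer $d\ge 1$, and it is rainbow under $c$ if $c(a)$, $c(a+d)$, $c(a+2d)$ are pairwise distinct. Let $g_r(A)$ denote the number of $r$-colorings of $A$ that contain no rainbow 3-AP. Theorem. For every integer $r\ge 3$ and every real number $\xi$ with $0<\xi\le \frac{3}{5+8\log_2 r}$, there exists $n_0\in\mathbb{N}$ such that for all $n\ge n_0$ and every $A\subseteq[n]$ with $|A|\ge(1-\xi)n$, $$g_r(A)\le\binom{r}{2}2^{|A|}+2^{-\frac{n}{36\log_2 n}}\,2^n .$$ -/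

import Mathlib

/-- The points `x`, `y`, `z` of `A` form, in this order, a 3-term arithmetic progression
with positive common difference. -/
def IsThreeAP {A : Finset ℕ} (x y z : A) : Prop :=
  ∃ d : ℕ, 0 < d ∧ (y : ℕ) = (x : ℕ) + d ∧ (z : ℕ) = (x : ℕ) + 2 * d

/-- The `r`-coloring `c` of `A` contains no rainbow 3-term arithmetic progression, that is,
no 3-term arithmetic progression of `A` whose terms get pairwise distinct colors. -/
def RainbowThreeAPFree {r : ℕ} {A : Finset ℕ} (c : A → Fin r) : Prop :=
  ¬ ∃ x y z : A, IsThreeAP x y z ∧ c x ≠ c y ∧ c x ≠ c z ∧ c y ≠ c z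

/-- The number of `r`-colorings of `A` without a rainbow 3-term arithmetic progression. -/
noncomputable def rainbowFreeCount (r : ℕ) (A : Finset ℕ) : ℕ :=
  Nat.card {c : A → Fin r // RainbowThreeAPFree c}

/-! Colorings with at most two colors account for the term with `r.choose 2`. It remains to show
that those with three or more colors number at most 2^((1-β)n) for a constant β > 0, which is
eventually smaller than the stated error term.

A rainbow-free coloring, seen as a subset of A × [r], is independent for the relation "rainbow
progression", in which two points have at most 3r completions. By `exists_containers` few sets cover
all independent sets, and in each of them few points lie in many rainbow triples. Such a container
is an assignment of color lists to A in which most x have few `conflicts`.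

Colorings from one container are bounded by stability (`card_threeColorings_cases`). Let m = n - |A|
and L = log₂ r. If some x with few conflicts has three colors, then at most about n/4 + 3m lists
have two or more colors, and at most about 2m have three or more. This leaves at most about 2^(n/4 +
3m + 2(L-1)m) colorings, and the bound on ξ makes the exponent smaller than n. Otherwise almost all
lists have at most two colors. If nearly all have exactly two, they equal a single pair D, and a
color outside D at some x forces equal colors on linearly many disjoint pairs; if not, the product
of the list sizes is already small. -/

open Finset

/-! ### Containers for sparse symmetric triple systems. -/

section Containers

variable {V : Type*}

open Classical in
/-- The number of ordered pairs of elements of `C` that `v` completes to a triple of `H`. -/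
noncomputable def linkDegree (H : V → V → V → Prop) (C : Finset V) (v : V) : ℕ :=
  #{p ∈ C ×ˢ C | H v p.1 p.2}

open Classical in
/-- The elements of `C` whose link in `C` has at least `t` ordered pairs. -/
noncomputable def heavy (H : V → V → V → Prop) (t : ℝ) (C : Finset V) : Finset V :=
  {v ∈ C | t ≤ linkDegree H C v}

open Classical in
/-- The elements of `C` that are not adjacent to `T` and have fewer than `τ` neighbours among the
elements of `C` not adjacent to `T`. -/
noncomputable def lowDegreePart (G : V → V → Prop) (τ : ℝ) (C T : Finset V) : Finset V :=
  {v ∈ C | (∀ t ∈ T, ¬ G t v) ∧ (#{w ∈ C | (∀ t ∈ T, ¬ G t w) ∧ G v w} : ℝ) < τ}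

open Classical in
lemma lowDegreePart_subset (G : V → V → Prop) (τ : ℝ) (C T : Finset V) :
    lowDegreePart G τ C T ⊆ C := filter_subset _ _

/-- `T` is a largest subset of `I` with at least `#T * τ` neighbours in `C`. An element of `I`
outside the low degree part would bring `τ` new neighbours and so enlarge `T`. -/
lemma exists_subset_lowDegreePart (G : V → V → Prop) {τ : ℝ} (hτ : 0 < τ) {C I : Finset V}
    (hIC : I ⊆ C) (hI : ∀ u ∈ I, ∀ w ∈ I, ¬ G u w) :
    ∃ T ⊆ I, #T * τ ≤ #C ∧ I ⊆ lowDegreePart G τ C T := by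
  classical
  obtain ⟨T, hT, hmax⟩ := exists_max_image
    ({T ∈ I.powerset | #T * τ ≤ #{w ∈ C | ∃ t ∈ T, G t w}}) card ⟨∅, by simp⟩
  simp only [mem_filter, mem_powerset] at hT hmax
  refine ⟨T, hT.1, hT.2.trans (by exact_mod_cast card_filter_le _ _), fun v hv ↦ ?_⟩
  simp only [lowDegreePart, mem_filter]
  refine ⟨hIC hv, fun t ht ↦ hI t (hT.1 ht) v hv, ?_⟩
  by_contra! hdeg
  have hvT : v ∉ T := by
    intro hvT
    have : #{w ∈ C | (∀ t ∈ T, ¬ G t w) ∧ G v w} = 0 := by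
      rw [card_eq_zero, filter_eq_empty_iff]
      exact fun w _ h ↦ h.1 v hvT h.2
    rw [this] at hdeg
    simp at hdeg
    linarith
  have hcard := card_insert_of_notMem hvT
  have := hmax (insert v T) ⟨insert_subset hv hT.1, by
    have hdisj : Disjoint {w ∈ C | ∃ t ∈ T, G t w}
        {w ∈ C | (∀ t ∈ T, ¬ G t w) ∧ G v w} := by
      rw [disjoint_filter]
      rintro w _ ⟨t, ht, h⟩ ⟨h', _⟩
      exact h' t ht h
    have hsub : {w ∈ C | ∃ t ∈ T, G t w} ∪ {w ∈ C | (∀ t ∈ T, ¬ G t w) ∧ G v w} ⊆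
        {w ∈ C | ∃ t ∈ insert v T, G t w} := by
      intro w
      simp only [mem_union, mem_filter, mem_insert]
      rintro (⟨hw, t, ht, h⟩ | ⟨hw, _, h⟩)
      · exact ⟨hw, t, Or.inr ht, h⟩
      · exact ⟨hw, v, Or.inl rfl, h⟩
    have hle := card_le_card hsub
    rw [card_union_of_disjoint hdisj] at hle
    have hle' : (#{w ∈ C | ∃ t ∈ T, G t w} : ℝ) + #{w ∈ C | (∀ t ∈ T, ¬ G t w) ∧ G v w} ≤
        #{w ∈ C | ∃ t ∈ insert v T, G t w} := by exact_mod_cast hle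
    rw [hcard]
    push_cast
    linarith [hT.2]⟩
  omega

-- Inside the low degree part each element has fewer than `τ` neighbours. Every other pair has an
-- end in the removed part, and each removed element accounts for at most `2 * Δ` ordered pairs.
open Classical in
lemma card_edges_le (G : V → V → Prop) (hG : ∀ u w, G u w → G w u) {τ : ℝ} (hτ : 0 < τ)
    (C T : Finset V) {Δ : ℕ} (hΔ : ∀ u, #{w ∈ C | G u w} ≤ Δ) :
    (#{p ∈ C ×ˢ C | G p.1 p.2} : ℝ) ≤ τ * #C + 2 * Δ * #(C \ lowDegreePart G τ C T) := by
  set R := lowDegreePart G τ C T with hR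
  have hRC : R ⊆ C := lowDegreePart_subset _ _ _ _
  have hsum : #{p ∈ C ×ˢ C | G p.1 p.2} = ∑ u ∈ C, #{w ∈ C | G u w} := by
    rw [card_filter, sum_product]
    simp only [card_filter]
  have hR1 : ∀ u ∈ R, (#{w ∈ C | G u w} : ℝ) ≤ τ + #{w ∈ C \ R | G u w} := by
    intro u hu
    have hu' := (mem_filter.1 (hR ▸ hu)).2.2
    have : {w ∈ C | G u w} ⊆
        {w ∈ C | (∀ t ∈ T, ¬ G t w) ∧ G u w} ∪ {w ∈ C \ R | G u w} := by
      intro w hw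
      simp only [mem_filter, mem_union, mem_sdiff] at hw ⊢
      by_cases h : ∀ t ∈ T, ¬ G t w
      · exact Or.inl ⟨hw.1, h, hw.2⟩
      · exact Or.inr ⟨⟨hw.1, fun hwR ↦ h (mem_filter.1 (hR ▸ hwR)).2.1⟩, hw.2⟩
    have h2 : (#{w ∈ C | G u w} : ℝ) ≤
        #{w ∈ C | (∀ t ∈ T, ¬ G t w) ∧ G u w} + #{w ∈ C \ R | G u w} := by
      exact_mod_cast (card_le_card this).trans (card_union_le _ _)
    linarith
  have hR2 : (∑ u ∈ R, #{w ∈ C \ R | G u w}) ≤ Δ * #(C \ R) := by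
    have := sum_card_bipartiteAbove_eq_sum_card_bipartiteBelow (s := R) (t := C \ R) G
    simp only [bipartiteAbove, bipartiteBelow] at this
    rw [this, mul_comm]
    refine sum_le_card_nsmul _ _ _ fun w _ ↦ (card_le_card ?_).trans (hΔ w)
    intro u hu
    simp only [mem_filter] at hu ⊢
    exact ⟨hRC hu.1, hG _ _ hu.2⟩
  have hR3 : (∑ u ∈ C \ R, #{w ∈ C | G u w}) ≤ Δ * #(C \ R) := by
    rw [mul_comm]
    exact sum_le_card_nsmul _ _ _ fun w _ ↦ hΔ w
  have h4 : (∑ u ∈ R, (#{w ∈ C | G u w} : ℝ)) ≤ #R * τ + ∑ u ∈ R, (#{w ∈ C \ R | G u w} : ℝ) := by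
    refine (sum_le_sum hR1).trans_eq ?_
    rw [sum_add_distrib]
    simp
  have h5 : (#R : ℝ) ≤ #C := by exact_mod_cast card_le_card hRC
  have hR2' : (∑ u ∈ R, (#{w ∈ C \ R | G u w} : ℝ)) ≤ Δ * #(C \ R) := by exact_mod_cast hR2
  have hR3' : (∑ u ∈ C \ R, (#{w ∈ C | G u w} : ℝ)) ≤ Δ * #(C \ R) := by exact_mod_cast hR3
  rw [hsum]
  push_cast
  rw [← sum_sdiff hRC]
  nlinarith

/-- A ternary relation, symmetric in its three arguments, in which every pair is completed to a
triple by at most `D` elements. -/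
structure IsSparseTriple (H : V → V → V → Prop) (D : ℕ) : Prop where
  swap_left : ∀ {x y z}, H x y z → H y x z
  swap_right : ∀ {x y z}, H x y z → H x z y
  codegree : ∀ x y, Nat.card {z // H x y z} ≤ D

/-- The union of the links of the elements of `S`. -/
def linkGraph (H : V → V → V → Prop) (S : Finset V) (u w : V) : Prop := ∃ v ∈ S, H v u w

variable [Fintype V] {H : V → V → V → Prop} {D : ℕ}

open Classical in
lemma IsSparseTriple.card_filter_le (hH : IsSparseTriple H D) (C : Finset V) (x y : V) :
    #{z ∈ C | H x y z} ≤ D := by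
  refine le_trans (card_le_card (filter_subset_filter _ (subset_univ C))) ?_
  have := hH.codegree x y
  rwa [Nat.card_eq_fintype_card, Fintype.card_subtype] at this

open Classical in
lemma IsSparseTriple.card_linkGraph_le (hH : IsSparseTriple H D) (C S : Finset V) (u : V) :
    #{w ∈ C | linkGraph H S u w} ≤ D * #S := by
  have : {w ∈ C | linkGraph H S u w} ⊆ S.biUnion fun v ↦ {w ∈ C | H v u w} := by
    intro w hw
    obtain ⟨hw, v, hv, h⟩ := mem_filter.1 hw
    exact mem_biUnion.2 ⟨v, hv, mem_filter.2 ⟨hw, h⟩⟩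
  refine (card_le_card this).trans (card_biUnion_le.trans ?_)
  rw [mul_comm]
  exact sum_le_card_nsmul _ _ _ fun v _ ↦ hH.card_filter_le C v u

-- A pair lies in the links of at most `D` elements of `S`, so overlaps between links cost only a
-- factor `D`.
open Classical in
lemma IsSparseTriple.sum_linkDegree_le (hH : IsSparseTriple H D) (C S : Finset V) :
    ∑ v ∈ S, linkDegree H C v ≤ D * #{p ∈ C ×ˢ C | linkGraph H S p.1 p.2} := by
  have := sum_card_bipartiteAbove_eq_sum_card_bipartiteBelow (s := S) (t := C ×ˢ C)
    (fun v p ↦ H v p.1 p.2)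
  simp only [bipartiteAbove, bipartiteBelow] at this
  simp only [linkDegree]
  rw [this, ← sum_filter_of_ne (p := fun p : V × V ↦ linkGraph H S p.1 p.2), mul_comm]
  · refine sum_le_card_nsmul _ _ _ fun p _ ↦ (card_le_card ?_).trans
      (hH.card_filter_le S p.1 p.2)
    intro v hv
    simp only [mem_filter] at hv ⊢
    exact ⟨hv.1, hH.swap_right (hH.swap_left hv.2)⟩
  · intro p _ hp
    obtain ⟨v, hv⟩ := card_pos.1 (Nat.pos_of_ne_zero hp)
    exact ⟨v, mem_filter.1 hv⟩

open Classical in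
/-- The container obtained from `C` and the fingerprints `S` and `T`. -/
noncomputable def shrink (H : V → V → V → Prop) (t τ : ℝ) (K : ℕ) (C S T : Finset V) :
    Finset V :=
  if (#(heavy H t C) : ℝ) < t then C
  else if #S < K then C \ (heavy H t C \ S)
  else lowDegreePart (linkGraph H S) τ C T

/-- If `I` has fewer than `K` heavy elements, they form `S` and the other heavy ones, at least half,
are discarded. Otherwise `I` is independent in the link graph of `K` of its heavy elements; that
graph has many edges and degrees at most `D * K`, so a positive proportion of vertices falls outside
the low degree part. -/
lemma exists_subset_shrink (hH : IsSparseTriple H D) (hD : 0 < D) {γ : ℝ} (hγ : 0 < γ) {K : ℕ}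
    (hK : 0 < K) (hKγ : K ≤ γ / 2 * Fintype.card V) {C I : Finset V} (hIC : I ⊆ C)
    (hI : ∀ u ∈ I, ∀ v ∈ I, ∀ w ∈ I, ¬ H u v w) :
    ∃ S T : Finset V, #S ≤ K ∧ #T * (K * γ / (2 * D)) ≤ Fintype.card V ∧
      I ⊆ shrink H (γ * Fintype.card V) (K * γ / (2 * D)) K C S T ∧
      ((#(heavy H (γ * Fintype.card V) C) : ℝ) < γ * Fintype.card V ∨
        (#(shrink H (γ * Fintype.card V) (K * γ / (2 * D)) K C S T) : ℝ) ≤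
          #C - γ / (4 * D ^ 2) * Fintype.card V) := by
  classical
  set N : ℝ := (Fintype.card V : ℝ) with hN
  set τ : ℝ := K * γ / (2 * D) with hτ
  have hD' : (1 : ℝ) ≤ D := by exact_mod_cast hD
  have hK' : (1 : ℝ) ≤ K := by exact_mod_cast hK
  have hN0 : 0 ≤ N := Nat.cast_nonneg _
  have hτ0 : 0 < τ := by positivity
  have hCN : (#C : ℝ) ≤ N := Nat.cast_le.2 (card_le_univ C)
  by_cases hterm : (#(heavy H (γ * N) C) : ℝ) < γ * N
  · exact ⟨∅, ∅, by simp, by simpa using hN0, by simpa [shrink, hterm] using hIC, Or.inl hterm⟩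
  have hheavy : heavy H (γ * N) C ⊆ C := filter_subset _ _
  by_cases hsmall : #(I ∩ heavy H (γ * N) C) < K
  · refine ⟨I ∩ heavy H (γ * N) C, ∅, hsmall.le, by simpa using hN0, ?_, Or.inr ?_⟩
    · simp only [shrink, hterm, hsmall, if_true, if_false]
      intro v hv
      simp only [mem_sdiff, mem_inter, not_and]
      exact ⟨hIC hv, fun h h' ↦ h' hv h⟩
    · simp only [shrink, hterm, hsmall, if_true, if_false]
      have h1 : heavy H (γ * N) C \ (I ∩ heavy H (γ * N) C) ⊆ C := sdiff_subset.trans hheavy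
      have h2 := card_sdiff_add_card_eq_card h1
      have h3 := card_sdiff_add_card_eq_card
        (inter_subset_right : I ∩ heavy H (γ * N) C ⊆ heavy H (γ * N) C)
      have h2' : (#(C \ (heavy H (γ * N) C \ (I ∩ heavy H (γ * N) C))) : ℝ) +
        #(heavy H (γ * N) C \ (I ∩ heavy H (γ * N) C)) = #C := by exact_mod_cast h2
      have h3' : (#(heavy H (γ * N) C \ (I ∩ heavy H (γ * N) C)) : ℝ) +
        #(I ∩ heavy H (γ * N) C) = #(heavy H (γ * N) C) := by exact_mod_cast h3
      have h4 : (#(I ∩ heavy H (γ * N) C) : ℝ) ≤ K := by exact_mod_cast hsmall.le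
      have h5 : γ / (4 * D ^ 2) * N ≤ γ / 2 * N := by
        gcongr
        nlinarith
      linarith
  · obtain ⟨S, hS, hSK⟩ := exists_subset_card_eq (not_lt.1 hsmall)
    obtain ⟨T, -, hT, hIT⟩ := exists_subset_lowDegreePart (linkGraph H S) hτ0 hIC (by
      rintro u hu w hw ⟨v, hv, h⟩
      exact hI v (mem_inter.1 (hS hv)).1 u hu w hw h)
    have hnext : shrink H (γ * N) τ K C S T = lowDegreePart (linkGraph H S) τ C T := by
      simp [shrink, hterm, hSK]
    refine ⟨S, T, hSK.le, hT.trans hCN, hnext ▸ hIT, Or.inr ?_⟩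
    rw [hnext]
    have hedges := card_edges_le (linkGraph H S)
      (fun u w ⟨v, hv, h⟩ ↦ ⟨v, hv, hH.swap_right h⟩) hτ0 C T (hH.card_linkGraph_le C S)
    have hdeg := hH.sum_linkDegree_le C S
    have hdeg' : (∑ v ∈ S, (linkDegree H C v : ℝ)) ≤
      D * #{p ∈ C ×ˢ C | linkGraph H S p.1 p.2} := by exact_mod_cast hdeg
    have hlow : K * (γ * N) ≤ ∑ v ∈ S, (linkDegree H C v : ℝ) := by
      rw [← hSK, ← nsmul_eq_mul]
      exact card_nsmul_le_sum _ _ _ fun v hv ↦ (mem_filter.1 (mem_inter.1 (hS hv)).2).2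
    have hsd := card_sdiff_add_card_eq_card
      (lowDegreePart_subset (linkGraph H S) τ C T)
    have hsd' : (#(C \ lowDegreePart (linkGraph H S) τ C T) : ℝ) +
      #(lowDegreePart (linkGraph H S) τ C T) = #C := by exact_mod_cast hsd
    rw [hSK] at hedges
    push_cast at hedges
    set x := (#(C \ lowDegreePart (linkGraph H S) τ C T) : ℝ)
    have hτC : τ * #C ≤ τ * N := by gcongr
    have hKx : K * (γ * N) ≤ D * (τ * N + 2 * (D * K) * x) :=
      hlow.trans (hdeg'.trans (by gcongr; linarith))
    -- With this `τ`, pairs inside the low degree part account for at most half of the lower bound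
    -- `K * (γ * N)`.
    have hDτ : D * τ = K * γ / 2 := by rw [hτ]; field_simp
    have hKx' : K * (γ * N / 2) ≤ K * (2 * D ^ 2 * x) := by
      have : D * (τ * N + 2 * (D * K) * x) = (D * τ) * N + K * (2 * D ^ 2 * x) := by ring
      rw [this, hDτ] at hKx
      linarith
    have hx := le_of_mul_le_mul_left hKx' (by linarith)
    have : γ / (4 * D ^ 2) * N ≤ x := by
      rw [div_mul_eq_mul_div, div_le_iff₀ (by positivity)]
      linarith
    linarith

/-- For small `δ`, a set has few subsets of density at most `δ`. -/
lemma exists_card_small_subsets_le {ε : ℝ} (hε : 0 < ε) :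
    ∃ δ : ℝ, 0 < δ ∧ ∀ (W : Type) [Fintype W],
      (#{S : Finset W | (#S : ℝ) ≤ δ * Fintype.card W} : ℝ) ≤ 2 ^ (ε * Fintype.card W) := by
  have hl2 := Real.log_pos one_lt_two
  set x : ℝ := min (1 / 2) (ε * Real.log 2 / 2) with hx
  have hx0 : 0 < x := by positivity
  have hx1 : x ≤ 1 / 2 := min_le_left _ _
  have hx2 : x ≤ ε * Real.log 2 / 2 := min_le_right _ _
  have hlx : Real.log x < 0 := Real.log_neg hx0 (by linarith)
  set δ : ℝ := ε * Real.log 2 / (2 * -Real.log x) with hδ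
  have hδ0 : 0 < δ := by
    have : 0 < -Real.log x := by linarith
    positivity
  refine ⟨δ, hδ0, fun W _ ↦ ?_⟩
  classical
  set N : ℝ := (Fintype.card W : ℝ) with hN
  have hN0 : 0 ≤ N := Nat.cast_nonneg _
  -- Give `S` the weight `x ^ #S`: the total is at most 2^(εN/2), while each small set weighs at
  -- least x^(δN) = 2^(-εN/2).
  have hsum : ∑ S : Finset W, x ^ #S = (1 + x) ^ Fintype.card W := by
    have := prod_add (fun _ : W ↦ x) (fun _ ↦ (1 : ℝ)) univ
    simp only [prod_const, one_pow, mul_one, powerset_univ] at this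
    rw [← this, card_univ, add_comm]
  have h1 : (#{S : Finset W | (#S : ℝ) ≤ δ * N} : ℝ) * x ^ (δ * N) ≤
      (1 + x) ^ Fintype.card W := by
    rw [← hsum, ← nsmul_eq_mul]
    refine (card_nsmul_le_sum _ (fun S ↦ x ^ #S) _ fun S hS ↦ ?_).trans
      (sum_le_sum_of_subset_of_nonneg (subset_univ _) fun _ _ _ ↦ by positivity)
    rw [← Real.rpow_natCast]
    exact Real.rpow_le_rpow_of_exponent_ge hx0 (by linarith) (mem_filter.1 hS).2
  have h2 : (1 + x) ^ Fintype.card W ≤ Real.exp (x * N) := by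
    rw [mul_comm, Real.exp_nat_mul]
    gcongr
    linarith [Real.add_one_le_exp x]
  have h3 : x ^ (δ * N) = Real.exp (-(ε * Real.log 2 / 2) * N) := by
    rw [Real.rpow_def_of_pos hx0]
    congr 1
    rw [hδ]
    have := hlx.ne
    field_simp
  have h4 : (2 : ℝ) ^ (ε * N) = Real.exp (ε * Real.log 2 / 2 * N) *
      Real.exp (ε * Real.log 2 / 2 * N) := by
    rw [Real.rpow_def_of_pos two_pos, ← Real.exp_add]
    congr 1
    ring
  rw [h3, neg_mul, Real.exp_neg, ← div_eq_mul_inv, div_le_iff₀ (Real.exp_pos _)] at h1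
  rw [h4]
  refine h1.trans ?_
  gcongr
  exact h2.trans (Real.exp_le_exp.2 (by gcongr))

/-- Containers for the independent sets of a symmetric ternary relation of bounded codegree. -/
theorem exists_containers (D : ℕ) (hD : 0 < D) {γ ε : ℝ} (hγ : 0 < γ) (hε : 0 < ε) :
    ∃ N₀ : ℕ, ∀ (W : Type) [Fintype W] (H : W → W → W → Prop), IsSparseTriple H D →
      N₀ ≤ Fintype.card W → ∃ F : Finset (Finset W), (#F : ℝ) ≤ 2 ^ (ε * Fintype.card W) ∧
        ∀ I : Finset W, (∀ u ∈ I, ∀ v ∈ I, ∀ w ∈ I, ¬ H u v w) → ∃ C ∈ F, I ⊆ C ∧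
          (#(heavy H (γ * Fintype.card W) C) : ℝ) < γ * Fintype.card W := by
  have hD' : (0 : ℝ) < D := by exact_mod_cast hD
  set η : ℝ := γ / (4 * D ^ 2) with hη
  have hη0 : 0 < η := by positivity
  obtain ⟨k, hk⟩ := exists_nat_gt (1 / η)
  have hk0 : (0 : ℝ) < k := lt_trans (by positivity) hk
  obtain ⟨δ, hδ, hsmall⟩ := exists_card_small_subsets_le (ε := ε / (2 * k)) (by positivity)
  -- `K` is independent of `N`, but large enough that `#T ≤ N / τ` implies `#T ≤ δ * N`.
  obtain ⟨K, hK⟩ := exists_nat_gt (2 * D / (γ * δ))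
  have hK0 : (0 : ℝ) < K := lt_trans (by positivity) hK
  obtain ⟨N₀, hN₀⟩ := exists_nat_ge (K / δ + K / (γ / 2) + 1)
  refine ⟨N₀, fun W _ H hH hW ↦ ?_⟩
  classical
  set N : ℝ := (Fintype.card W : ℝ) with hN
  have hNN : K / δ + K / (γ / 2) + 1 ≤ N := hN₀.trans (Nat.cast_le.2 hW)
  have h1 : 0 < K / δ := by positivity
  have h2 : 0 < K / (γ / 2) := by positivity
  have hN0 : 0 < N := by linarith
  have hKδ : K ≤ δ * N := by
    rw [← div_le_iff₀' hδ]; linarith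
  have hKγ : K ≤ γ / 2 * N := by
    rw [← div_le_iff₀' (by positivity)]; linarith
  set τ : ℝ := K * γ / (2 * D) with hτ
  have hτδ : 1 ≤ δ * τ := by
    rw [div_lt_iff₀ (by positivity)] at hK
    rw [hτ, mul_div_assoc', le_div_iff₀ (by positivity)]
    linarith
  set small : Finset (Finset W) := {S | (#S : ℝ) ≤ δ * N} with hsm
  -- Each round costs a choice of two small fingerprints and removes `η * N` elements from every
  -- unfinished container. As `k * η > 1`, none is unfinished after `k` rounds.
  have key : ∀ j : ℕ, ∃ F : Finset (Finset W), #F ≤ (#small * #small) ^ j ∧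
      ∀ I : Finset W, (∀ u ∈ I, ∀ v ∈ I, ∀ w ∈ I, ¬ H u v w) → ∃ C ∈ F, I ⊆ C ∧
        ((#(heavy H (γ * N) C) : ℝ) < γ * N ∨ (#C : ℝ) ≤ N - j * (η * N)) := by
    intro j
    induction j with
    | zero =>
      refine ⟨{univ}, by simp, fun I _ ↦ ⟨univ, by simp, subset_univ _, Or.inr ?_⟩⟩
      simp [hN]
    | succ j ih =>
      obtain ⟨F, hF, hcover⟩ := ih
      refine ⟨F.biUnion fun C ↦ (small ×ˢ small).image fun p ↦
        shrink H (γ * N) τ K C p.1 p.2, ?_, fun I hI ↦ ?_⟩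
      · rw [pow_succ]
        refine (card_biUnion_le_card_mul _ _ _ fun C _ ↦ card_image_le).trans ?_
        rw [card_product]
        gcongr
      · obtain ⟨C, hC, hIC, hsize⟩ := hcover I hI
        obtain ⟨S, T, hS, hT, hsub, hred⟩ := exists_subset_shrink hH hD hγ
          (by exact_mod_cast hK0) hKγ hIC hI
        have hSs : S ∈ small := by
          simp only [hsm, mem_filter, mem_univ, true_and]
          exact le_trans (by exact_mod_cast hS) hKδ
        have hTs : T ∈ small := by
          simp only [hsm, mem_filter, mem_univ, true_and]
          have : (#T : ℝ) * 1 ≤ #T * (δ * τ) := by gcongr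
          have h3 : δ * (#T * τ) ≤ δ * N := by gcongr
          linarith
        refine ⟨_, mem_biUnion.2 ⟨C, hC, mem_image.2 ⟨(S, T), mk_mem_product hSs hTs, rfl⟩⟩,
          hsub, ?_⟩
        by_cases hterm : (#(heavy H (γ * N) C) : ℝ) < γ * N
        · left
          simp [shrink, hterm]
        · right
          have h3 := hsize.resolve_left hterm
          have h4 := hred.resolve_left hterm
          push_cast
          linarith
  obtain ⟨F, hF, hcover⟩ := key k
  refine ⟨F, ?_, fun I hI ↦ ?_⟩
  · have h3 : (#F : ℝ) ≤ ((#small : ℝ) * #small) ^ k := by exact_mod_cast hF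
    have h4 := hsmall W
    refine h3.trans ((pow_le_pow_left₀ (by positivity)
      (mul_le_mul h4 h4 (by positivity) (by positivity)) k).trans_eq ?_)
    rw [← Real.rpow_add two_pos, ← Real.rpow_mul_natCast two_pos.le]
    congr 1
    field_simp
    ring
  · obtain ⟨C, hC, hIC, h | h⟩ := hcover I hI
    · exact ⟨C, hC, hIC, h⟩
    · exfalso
      rw [div_lt_iff₀ hη0] at hk
      have : 1 * N < k * η * N := by gcongr
      have := (Nat.cast_nonneg #C : (0 : ℝ) ≤ _)
      linarith

end Containers

/-! ### Stability of color lists with few rainbow choices. -/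

section Stability

/-- The distinct numbers `x`, `y`, `z` are, in some order, a 3-term arithmetic progression. -/
def FormAP (x y z : ℕ) : Prop := x ≠ y ∧ (x + z = 2 * y ∨ x + y = 2 * z ∨ y + z = 2 * x)

/-- One can choose pairwise distinct elements of the three sets. -/
def HasRainbow {r : ℕ} (s t u : Finset (Fin r)) : Prop :=
  ∃ i ∈ s, ∃ j ∈ t, ∃ k ∈ u, i ≠ j ∧ i ≠ k ∧ j ≠ k

variable {r : ℕ}

lemma hasRainbow_of_card {s t u : Finset (Fin r)} (hs : 3 ≤ #s) (ht : 2 ≤ #t) (hu : 1 ≤ #u) :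
    HasRainbow s t u := by
  obtain ⟨k, hk⟩ := card_pos.1 hu
  obtain ⟨j, hj, hjk⟩ := exists_mem_ne (by omega : 1 < #t) k
  obtain ⟨i, hi, hi'⟩ := exists_mem_notMem_of_card_lt_card
    (lt_of_le_of_lt (card_le_two (a := j) (b := k)) (by omega : 2 < #s))
  simp only [mem_insert, mem_singleton, not_or] at hi'
  exact ⟨i, hi, j, hj, k, hk, hi'.1, hi'.2, hjk⟩

/-- A color of `t` outside `s` would extend to a rainbow choice: avoid it in `u`, then avoid the
color from `u` in `s`. -/
lemma eq_of_not_hasRainbow {s t u : Finset (Fin r)} (hs : #s = 2) (ht : #t = 2) (hu : #u = 2)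
    (h : ¬ HasRainbow s t u) : t = s := by
  by_contra hne
  obtain ⟨j, hj, hjs⟩ : ∃ j ∈ t, j ∉ s := by
    by_contra! hsub
    exact hne (eq_of_subset_of_card_le hsub (by omega))
  obtain ⟨k, hk, hkj⟩ := exists_mem_ne (by omega : 1 < #u) j
  obtain ⟨i, hi, hik⟩ := exists_mem_ne (by omega : 1 < #s) k
  exact h ⟨i, hi, j, hj, k, hk, fun e ↦ hjs (e ▸ hi), hik, hkj.symm⟩

open Classical in
/-- The elements of `A` that are in a progression of `A` with `x` from which the lists of `P`
allow a rainbow choice. -/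
noncomputable def conflicts (P : ℕ → Finset (Fin r)) (A : Finset ℕ) (x : ℕ) : Finset ℕ :=
  {y ∈ A | ∃ z ∈ A, FormAP x y z ∧ HasRainbow (P x) (P y) (P z)}

open Classical in
/-- At most about a quarter of a set that is dense in `[n]` is in no progression with `x`. -/
lemma card_no_formAP_le {n x : ℕ} (hx : x ∈ Icc 1 n) {Q : Finset ℕ} (hQ : Q ⊆ Icc 1 n) :
    4 * #{y ∈ Q | ∀ z ∈ Q, ¬ FormAP x y z} ≤ n + 8 + 12 * #(Icc 1 n \ Q) := by
  rw [mem_Icc] at hx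
  set M := Icc 1 n \ Q with hM
  have hmem : ∀ z, 1 ≤ z → z ≤ n → z ∉ Q → z ∈ M := fun z h1 h2 h3 ↦
    mem_sdiff.2 ⟨mem_Icc.2 ⟨h1, h2⟩, h3⟩
  set iso : Finset ℕ := {y ∈ Icc 1 n | y ≠ x ∧ ∀ z ∈ Icc 1 n, ¬ FormAP x y z} with hiso
  -- Unless `y` is `x` or already isolated in `[n]`, a third term is missing from `Q`. It determines
  -- `y` up to three positions, whence three times `#M`.
  have hcover : {y ∈ Q | ∀ z ∈ Q, ¬ FormAP x y z} ⊆ {x} ∪ iso ∪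
      ({y ∈ Icc 1 n | 2 * x - y ∈ M ∧ y < 2 * x} ∪ {y ∈ Icc 1 n | 2 * y - x ∈ M ∧ x < 2 * y} ∪
        {y ∈ Icc 1 n | (x + y) / 2 ∈ M ∧ (x + y) % 2 = 0}) := by
    intro y hy
    obtain ⟨hyQ, hy⟩ := mem_filter.1 hy
    have hyI := hQ hyQ
    by_cases hyx : y = x
    · simp [hyx]
    by_cases hyiso : y ∈ iso
    · simp [hyiso]
    simp only [hiso, mem_filter, not_and, not_forall, not_not] at hyiso
    obtain ⟨z, hz, hF⟩ := hyiso hyI hyx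
    have hzM : z ∈ M := mem_sdiff.2 ⟨hz, fun h ↦ hy z h hF⟩
    rw [mem_Icc] at hyI hz
    refine mem_union_right _ ?_
    simp only [mem_union, mem_filter, mem_Icc]
    obtain ⟨-, h | h | h⟩ := hF
    · left; right
      have : 2 * y - x = z := by omega
      exact ⟨hyI, this ▸ hzM, by omega⟩
    · right
      have : (x + y) / 2 = z := by omega
      exact ⟨hyI, this ▸ hzM, by omega⟩
    · left; left
      have : 2 * x - y = z := by omega
      exact ⟨hyI, this ▸ hzM, by omega⟩
  have h1 : #{y ∈ Icc 1 n | 2 * x - y ∈ M ∧ y < 2 * x} ≤ #M := by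
    refine card_le_card_of_injOn (fun y ↦ 2 * x - y) (fun y hy ↦ (mem_filter.1 hy).2.1) ?_
    intro y hy y' hy' h
    simp only [coe_filter, Set.mem_ofPred_eq] at hy hy' h
    omega
  have h2 : #{y ∈ Icc 1 n | 2 * y - x ∈ M ∧ x < 2 * y} ≤ #M := by
    refine card_le_card_of_injOn (fun y ↦ 2 * y - x) (fun y hy ↦ (mem_filter.1 hy).2.1) ?_
    intro y hy y' hy' h
    simp only [coe_filter, Set.mem_ofPred_eq] at hy hy' h
    omega
  have h3 : #{y ∈ Icc 1 n | (x + y) / 2 ∈ M ∧ (x + y) % 2 = 0} ≤ #M := by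
    refine card_le_card_of_injOn (fun y ↦ (x + y) / 2) (fun y hy ↦ (mem_filter.1 hy).2.1) ?_
    intro y hy y' hy' h
    simp only [coe_filter, Set.mem_ofPred_eq] at hy hy' h
    omega
  have h4 : #iso ≤ n / 4 + 1 := by
    rw [← card_range (n / 4 + 1)]
    have hprop : ∀ y ∈ iso, 1 ≤ y ∧ y ≤ n ∧ (x + y) % 2 = 1 ∧ (2 * y ≤ x ∨ n < 2 * y - x) ∧
        (2 * x ≤ y ∨ n < 2 * x - y) := by
      intro y hy
      simp only [hiso, mem_filter, mem_Icc] at hy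
      obtain ⟨hyI, hyx, hy⟩ := hy
      refine ⟨hyI.1, hyI.2, ?_, ?_, ?_⟩
      · by_contra h
        exact hy ((x + y) / 2) (by omega) ⟨hyx.symm, by omega⟩
      · by_contra! h
        exact hy (2 * y - x) (by omega) ⟨hyx.symm, by omega⟩
      · by_contra! h
        exact hy (2 * x - y) (by omega) ⟨hyx.symm, by omega⟩
    -- For `x` in the lower half only `y > (n + x) / 2` can be isolated, otherwise only `y ≤ x / 2`.
    -- This is at most half of `[n]`, and the fixed parity of `y` halves it again.
    rcases le_or_gt (2 * x) (n + 1) with hxn | hxn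
    · refine card_le_card_of_injOn (fun y ↦ (n - y) / 2) (fun y hy ↦ ?_) ?_
      · have := hprop y hy
        simp only [coe_range, Set.mem_Iio]
        omega
      · intro y hy y' hy' h
        have := hprop y hy
        have := hprop y' hy'
        simp only at h
        omega
    · refine card_le_card_of_injOn (fun y ↦ (y - 1) / 2) (fun y hy ↦ ?_) ?_
      · have := hprop y hy
        simp only [coe_range, Set.mem_Iio]
        omega
      · intro y hy y' hy' h
        have := hprop y hy
        have := hprop y' hy'
        simp only at h
        omega
  have h5 := card_le_card hcover
  have h6 := card_union_le ({x} ∪ iso)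
    ({y ∈ Icc 1 n | 2 * x - y ∈ M ∧ y < 2 * x} ∪ {y ∈ Icc 1 n | 2 * y - x ∈ M ∧ x < 2 * y} ∪
        {y ∈ Icc 1 n | (x + y) / 2 ∈ M ∧ (x + y) % 2 = 0})
  have h7 := card_union_le {x} iso
  have h8 := card_union_le
    ({y ∈ Icc 1 n | 2 * x - y ∈ M ∧ y < 2 * x} ∪ {y ∈ Icc 1 n | 2 * y - x ∈ M ∧ x < 2 * y})
    {y ∈ Icc 1 n | (x + y) / 2 ∈ M ∧ (x + y) % 2 = 0}
  have h9 := card_union_le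
    {y ∈ Icc 1 n | 2 * x - y ∈ M ∧ y < 2 * x} {y ∈ Icc 1 n | 2 * y - x ∈ M ∧ x < 2 * y}
  rw [card_singleton] at h7
  omega

variable {n g : ℕ} {A : Finset ℕ} {P : ℕ → Finset (Fin r)}

/-- Lists of sizes 3, 2 and 1 always allow a rainbow choice, so such a `y` is in conflict with `x`
or shares no progression of `A` with it. -/
lemma card_two_le_card_le (hA : A ⊆ Icc 1 n) (hP : ∀ x ∈ A, (P x).Nonempty) {x : ℕ} (hx : x ∈ A)
    (hx3 : 3 ≤ #(P x)) (hxg : #(conflicts P A x) ≤ g) :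
    4 * #{y ∈ A | 2 ≤ #(P y)} ≤ n + 8 + 12 * #(Icc 1 n \ A) + 4 * g := by
  classical
  have hsub : {y ∈ A | 2 ≤ #(P y)} ⊆ {y ∈ A | ∀ z ∈ A, ¬ FormAP x y z} ∪ conflicts P A x := by
    intro y hy
    obtain ⟨hyA, hy2⟩ := mem_filter.1 hy
    by_cases h : ∀ z ∈ A, ¬ FormAP x y z
    · exact mem_union_left _ (mem_filter.2 ⟨hyA, h⟩)
    · push Not at h
      obtain ⟨z, hz, hF⟩ := h
      exact mem_union_right _ (mem_filter.2 ⟨hyA, z, hz, hF,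
        hasRainbow_of_card hx3 hy2 (hP z hz).card_pos⟩)
  have h1 := (card_le_card hsub).trans (card_union_le _ _)
  have h2 := card_no_formAP_le (hA hx) hA
  omega

/-- The sets of large lists without many conflicts are at most twice the complement of `A`. -/
lemma card_three_le_card_le (hA : A ⊆ Icc 1 n) (hP : ∀ x ∈ A, (P x).Nonempty) {X : Finset ℕ}
    (hXA : X ⊆ A) (hX3 : ∀ x ∈ X, 3 ≤ #(P x)) (hXg : ∀ x ∈ X, #(conflicts P A x) ≤ g) :
    #X ≤ 2 * #(Icc 1 n \ A) + 2 * g + 2 := by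
  classical
  rcases X.eq_empty_or_nonempty with rfl | hne
  · simp
  set a := X.min' hne
  set b := X.max' hne
  have haX : a ∈ X := min'_mem _ _
  have hbX : b ∈ X := max'_mem _ _
  have ha := mem_Icc.1 (hA (hXA haX))
  have hb := mem_Icc.1 (hA (hXA hbX))
  set M := Icc 1 n \ A
  have hcover : X ⊆ ({a, b} ∪ (conflicts P A a ∪ conflicts P A b)) ∪
      ({y ∈ X | 2 * y - a ∈ M} ∪ {y ∈ X | 2 * y - b ∈ M ∧ b < 2 * y}) := by
    intro y hy
    by_cases hya : y = a
    · simp [hya]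
    by_cases hyb : y = b
    · simp [hyb]
    have hay : a ≤ y := min'_le _ _ hy
    have hby : y ≤ b := le_max' _ _ hy
    have key : ∀ c ∈ X, ∀ z ∈ A, FormAP c y z → y ∈ conflicts P A c := fun c hc z hz hF ↦
      mem_filter.2 ⟨hXA hy, z, hz, hF,
        hasRainbow_of_card (hX3 c hc) (by have := hX3 y hy; omega) (hP z hz).card_pos⟩
    -- Reflect `a` in `y`, or `b` if that exceeds `n`; by extremality the image lies in `[n]`. If it
    -- is in `A`, there is a conflict; otherwise it is in `M`.
    rcases le_or_gt (2 * y - a) n with h | h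
    · by_cases hz : 2 * y - a ∈ A
      · have := key a haX _ hz ⟨Ne.symm hya, by omega⟩
        simp [this]
      · have : 2 * y - a ∈ M := mem_sdiff.2 ⟨mem_Icc.2 ⟨by omega, h⟩, hz⟩
        simp [this, hy]
    · by_cases hz : 2 * y - b ∈ A
      · have := key b hbX _ hz ⟨Ne.symm hyb, by omega⟩
        simp [this]
      · have h1 : 2 * y - b ∈ M := mem_sdiff.2 ⟨mem_Icc.2 ⟨by omega, by omega⟩, hz⟩
        have h2 : b < 2 * y := by omega
        simp [h1, h2, hy]
  have h1 : #{y ∈ X | 2 * y - a ∈ M} ≤ #M := by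
    refine card_le_card_of_injOn (fun y ↦ 2 * y - a) (fun y hy ↦ (mem_filter.1 hy).2) ?_
    intro y hy y' hy' h
    have h1 : a ≤ y := min'_le _ _ (mem_filter.1 hy).1
    have h2 : a ≤ y' := min'_le _ _ (mem_filter.1 hy').1
    simp only at h
    omega
  have h2 : #{y ∈ X | 2 * y - b ∈ M ∧ b < 2 * y} ≤ #M := by
    refine card_le_card_of_injOn (fun y ↦ 2 * y - b) (fun y hy ↦ (mem_filter.1 hy).2.1) ?_
    intro y hy y' hy' h
    simp only [coe_filter, Set.mem_ofPred_eq] at hy hy' h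
    omega
  have h3 := (card_le_card hcover).trans (card_union_le _ _)
  have h4 := card_union_le {a, b} (conflicts P A a ∪ conflicts P A b)
  have h5 := card_union_le (conflicts P A a) (conflicts P A b)
  have h6 := card_union_le {y ∈ X | 2 * y - a ∈ M} {y ∈ X | 2 * y - b ∈ M ∧ b < 2 * y}
  have h7 := card_le_two (a := a) (b := b)
  have h8 := hXg a haX
  have h9 := hXg b hbX
  omega

/-- If almost all of `[n]` has lists of size two with few conflicts, these lists are equal. -/
lemma eq_of_card_eq_two (hA : A ⊆ Icc 1 n) {Y : Finset ℕ} (hYA : Y ⊆ A)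
    (hY2 : ∀ y ∈ Y, #(P y) = 2) (hYg : ∀ y ∈ Y, #(conflicts P A y) ≤ g)
    (hsize : n + 16 + 4 * g + 14 * #(Icc 1 n \ Y) < 2 * n) {x y : ℕ} (hx : x ∈ Y) (hy : y ∈ Y) :
    P y = P x := by
  classical
  by_contra hne
  have hYI := hYA.trans hA
  have key : ∀ x ∈ Y, 4 * #{z ∈ Y | P z ≠ P x} ≤ n + 8 + 12 * #(Icc 1 n \ Y) + 4 * g := by
    intro x hx
    have hsub : {z ∈ Y | P z ≠ P x} ⊆ {y ∈ Y | ∀ z ∈ Y, ¬ FormAP x y z} ∪ conflicts P A x := by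
      intro z hz
      obtain ⟨hzY, hz⟩ := mem_filter.1 hz
      by_cases h : ∀ w ∈ Y, ¬ FormAP x z w
      · exact mem_union_left _ (mem_filter.2 ⟨hzY, h⟩)
      · push Not at h
        obtain ⟨w, hw, hF⟩ := h
        refine mem_union_right _ (mem_filter.2 ⟨hYA hzY, w, hYA hw, hF, ?_⟩)
        by_contra hR
        exact hz (eq_of_not_hasRainbow (hY2 x hx) (hY2 z hzY) (hY2 w hw) hR)
    have h1 := (card_le_card hsub).trans (card_union_le _ _)
    have h2 := card_no_formAP_le (hYI hx) hYI
    have h3 := hYg x hx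
    omega
  -- Every list differs from `P x` or `P y`, but by `key` only about `n / 4` lists differ from each
  -- of them.
  have hcover : Y ⊆ {z ∈ Y | P z ≠ P x} ∪ {z ∈ Y | P z ≠ P y} := by
    intro z hz
    by_cases h : P z = P x
    · exact mem_union_right _ (mem_filter.2 ⟨hz, fun h' ↦ hne (h'.symm.trans h)⟩)
    · exact mem_union_left _ (mem_filter.2 ⟨hz, h⟩)
  have h1 := (card_le_card hcover).trans (card_union_le _ _)
  have h2 := key x hx
  have h3 := key y hy
  have h4 := card_sdiff_add_card_eq_card hYI
  rw [Nat.card_Icc] at h4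
  omega

/-- Around `x` one finds many disjoint pairs of elements of `Y` in progression with `x`. -/
lemma exists_formAP_matching {Y : Finset ℕ} {x : ℕ} (hx : x ∈ Icc 1 n) :
    ∃ Z ⊆ Y, n ≤ 8 * #Z + 16 * #(Icc 1 n \ Y) + 16 ∧
      ∀ z ∈ Z, ∃ y ∈ Y \ Z, FormAP x y z := by
  classical
  rw [mem_Icc] at hx
  have hmem : ∀ z, 1 ≤ z → z ≤ n → z ∉ Y → z ∈ Icc 1 n \ Y := fun z h1 h2 h3 ↦
    mem_sdiff.2 ⟨mem_Icc.2 ⟨h1, h2⟩, h3⟩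
  rcases le_or_gt (2 * x) n with h | h
  -- `z` lies in the upper half of `[x, n]`, so its midpoint with `x` lies in the lower half and
  -- outside `Z`. The other case is the mirror image, in `[1, x]`.
  · refine ⟨{z ∈ Y | (z + x) / 2 ∈ Y ∧ (z + x) % 2 = 0 ∧ n + x < 2 * z ∧ z ≤ n},
      filter_subset _ _, ?_, ?_⟩
    · set Z := {z ∈ Y | (z + x) / 2 ∈ Y ∧ (z + x) % 2 = 0 ∧ n + x < 2 * z ∧ z ≤ n} with hZ
      set E := Ioc ((n - x) / 4) ((n - x) / 2) with hE
      have hcover : E ⊆ {d ∈ E | x + 2 * d ∈ Z} ∪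
          ({d ∈ E | x + d ∈ Icc 1 n \ Y} ∪ {d ∈ E | x + 2 * d ∈ Icc 1 n \ Y}) := by
        intro d hd
        have hd' := mem_Ioc.1 hd
        by_cases h1 : x + d ∈ Y
        · by_cases h2 : x + 2 * d ∈ Y
          · refine mem_union_left _ (mem_filter.2 ⟨hd, mem_filter.2 ⟨h2, ?_⟩⟩)
            have : (x + 2 * d + x) / 2 = x + d := by omega
            refine ⟨this ▸ h1, ?_⟩
            omega
          · exact mem_union_right _ (mem_union_right _ (mem_filter.2
              ⟨hd, hmem _ (by omega) (by omega) h2⟩))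
        · exact mem_union_right _ (mem_union_left _ (mem_filter.2
              ⟨hd, hmem _ (by omega) (by omega) h1⟩))
      have i1 : #{d ∈ E | x + 2 * d ∈ Z} ≤ #Z :=
        card_le_card_of_injOn (fun d ↦ x + 2 * d) (fun d hd ↦ (mem_filter.1 hd).2)
          fun d _ d' _ hdd ↦ by simp only at hdd; omega
      have i2 : #{d ∈ E | x + d ∈ Icc 1 n \ Y} ≤ #(Icc 1 n \ Y) :=
        card_le_card_of_injOn (fun d ↦ x + d) (fun d hd ↦ (mem_filter.1 hd).2)
          fun d _ d' _ hdd ↦ by simp only at hdd; omega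
      have i3 : #{d ∈ E | x + 2 * d ∈ Icc 1 n \ Y} ≤ #(Icc 1 n \ Y) :=
        card_le_card_of_injOn (fun d ↦ x + 2 * d) (fun d hd ↦ (mem_filter.1 hd).2)
          fun d _ d' _ hdd ↦ by simp only at hdd; omega
      have i4 := (card_le_card hcover).trans (card_union_le _ _)
      have i5 := card_union_le {d ∈ E | x + d ∈ Icc 1 n \ Y} {d ∈ E | x + 2 * d ∈ Icc 1 n \ Y}
      have i6 : #E = (n - x) / 2 - (n - x) / 4 := Nat.card_Ioc _ _
      omega
    · intro z hz
      simp only [mem_filter] at hz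
      refine ⟨(z + x) / 2, ?_, ?_⟩
      · simp only [mem_sdiff, mem_filter]
        refine ⟨hz.2.1, fun h' ↦ ?_⟩
        omega
      · refine ⟨?_, ?_⟩ <;> omega
  · refine ⟨{z ∈ Y | (z + x) / 2 ∈ Y ∧ (z + x) % 2 = 0 ∧ 2 * z < x ∧ 1 ≤ z},
      filter_subset _ _, ?_, ?_⟩
    · set Z := {z ∈ Y | (z + x) / 2 ∈ Y ∧ (z + x) % 2 = 0 ∧ 2 * z < x ∧ 1 ≤ z} with hZ
      set E := Ioc (x / 4) ((x - 1) / 2) with hE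
      have hcover : E ⊆ {d ∈ E | x - 2 * d ∈ Z} ∪
          ({d ∈ E | x - d ∈ Icc 1 n \ Y} ∪ {d ∈ E | x - 2 * d ∈ Icc 1 n \ Y}) := by
        intro d hd
        have hd' := mem_Ioc.1 hd
        by_cases h1 : x - d ∈ Y
        · by_cases h2 : x - 2 * d ∈ Y
          · refine mem_union_left _ (mem_filter.2 ⟨hd, mem_filter.2 ⟨h2, ?_⟩⟩)
            have : (x - 2 * d + x) / 2 = x - d := by omega
            refine ⟨this ▸ h1, ?_⟩
            omega
          · exact mem_union_right _ (mem_union_right _ (mem_filter.2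
              ⟨hd, hmem _ (by omega) (by omega) h2⟩))
        · exact mem_union_right _ (mem_union_left _ (mem_filter.2
              ⟨hd, hmem _ (by omega) (by omega) h1⟩))
      have hEx : ∀ d ∈ E, 2 * d < x := fun d hd ↦ by have := mem_Ioc.1 hd; omega
      have i1 : #{d ∈ E | x - 2 * d ∈ Z} ≤ #Z :=
        card_le_card_of_injOn (fun d ↦ x - 2 * d) (fun d hd ↦ (mem_filter.1 hd).2)
          fun d hd d' hd' hdd ↦ by
            have := hEx d (mem_filter.1 hd).1
            have := hEx d' (mem_filter.1 hd').1
            simp only at hdd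
            omega
      have i2 : #{d ∈ E | x - d ∈ Icc 1 n \ Y} ≤ #(Icc 1 n \ Y) :=
        card_le_card_of_injOn (fun d ↦ x - d) (fun d hd ↦ (mem_filter.1 hd).2)
          fun d hd d' hd' hdd ↦ by
            have := hEx d (mem_filter.1 hd).1
            have := hEx d' (mem_filter.1 hd').1
            simp only at hdd
            omega
      have i3 : #{d ∈ E | x - 2 * d ∈ Icc 1 n \ Y} ≤ #(Icc 1 n \ Y) :=
        card_le_card_of_injOn (fun d ↦ x - 2 * d) (fun d hd ↦ (mem_filter.1 hd).2)
          fun d hd d' hd' hdd ↦ by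
            have := hEx d (mem_filter.1 hd).1
            have := hEx d' (mem_filter.1 hd').1
            simp only at hdd
            omega
      have i4 := (card_le_card hcover).trans (card_union_le _ _)
      have i5 := card_union_le {d ∈ E | x - d ∈ Icc 1 n \ Y} {d ∈ E | x - 2 * d ∈ Icc 1 n \ Y}
      have i6 : #E = (x - 1) / 2 - x / 4 := Nat.card_Ioc _ _
      omega
    · intro z hz
      simp only [mem_filter] at hz
      refine ⟨(z + x) / 2, ?_, ?_⟩
      · simp only [mem_sdiff, mem_filter]
        refine ⟨hz.2.1, fun h' ↦ ?_⟩
        omega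
      · refine ⟨?_, ?_⟩ <;> omega

end Stability

/-! ### Counting the colorings with at least three colors. -/

section Counting

variable {r n g : ℕ} {A : Finset ℕ} {P : ℕ → Finset (Fin r)}

lemma RainbowThreeAPFree.eq_of_formAP {c : A → Fin r} (hc : RainbowThreeAPFree c) {x y z : A}
    (h : FormAP x y z) (hxy : c x ≠ c y) (hxz : c x ≠ c z) : c y = c z := by
  by_contra hyz
  have key : ∀ a b d : A, (a : ℕ) < b → (a : ℕ) + d = 2 * b → c a ≠ c b → c a ≠ c d →
      c b ≠ c d → False := fun a b d h1 h2 h3 h4 h5 ↦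
    hc ⟨a, b, d, ⟨b - a, by omega, by omega, by omega⟩, h3, h4, h5⟩
  obtain ⟨hne, h | h | h⟩ := h
  · rcases lt_or_gt_of_ne hne with hlt | hlt
    · exact key x y z hlt h hxy hxz hyz
    · exact key z y x (by omega) (by omega) (Ne.symm hyz) hxz.symm hxy.symm
  · rcases lt_or_gt_of_ne hne with hlt | hlt
    · exact key x z y (by omega) h hxz hxy (Ne.symm hyz)
    · exact key y z x (by omega) (by omega) hyz hxy.symm hxz.symm
  · rcases lt_or_gt_of_ne hne with hlt | hlt
    · exact key z x y (by omega) (by omega) hxz.symm (Ne.symm hyz) hxy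
    · exact key y x z (by omega) h hxy.symm hyz hxz

lemma card_le_prod_of_determined {W : Finset ℕ} (hW : W ⊆ A) {𝒞 : Finset (A → Fin r)}
    (hP : ∀ c ∈ 𝒞, ∀ x : A, c x ∈ P x)
    (hdet : ∀ c ∈ 𝒞, ∀ c' ∈ 𝒞, (∀ x : A, (x : ℕ) ∈ W → c x = c' x) → c = c') :
    #𝒞 ≤ ∏ x ∈ W, #(P x) := by
  rw [← prod_coe_sort, ← Fintype.card_piFinset]
  refine card_le_card_of_injOn (fun c (x : W) ↦ c ⟨x, hW x.2⟩) (fun c hc ↦ ?_) ?_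
  · exact mem_coe.2 (Fintype.mem_piFinset.2 fun x ↦ hP c hc ⟨x, hW x.2⟩)
  · intro c hc c' hc' h
    exact hdet c hc c' hc' fun x hx ↦ congrFun h ⟨x, hx⟩

lemma prod_card_le (W : Finset ℕ) :
    ∏ x ∈ W, #(P x) ≤ r ^ #{x ∈ W | 3 ≤ #(P x)} * 2 ^ #{x ∈ W | #(P x) = 2} := by
  have h : ∀ x ∈ W, #(P x) ≤ (if 3 ≤ #(P x) then r else 1) * (if #(P x) = 2 then 2 else 1) := by
    intro x _
    have := card_finset_fin_le (P x)
    split_ifs <;> omega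
  refine (prod_le_prod' h).trans_eq ?_
  rw [prod_mul_distrib]
  simp only [prod_ite, prod_const, one_pow, mul_one]

open Classical in
/-- The rainbow-free colorings of `A` from the lists of `P` that use at least three colors. -/
noncomputable def threeColorings (P : ℕ → Finset (Fin r)) (A : Finset ℕ) :
    Finset (A → Fin r) :=
  {c | RainbowThreeAPFree c ∧ (∀ x : A, c x ∈ P x) ∧ ¬ ∃ D : Finset (Fin r), #D = 2 ∧ ∀ x, c x ∈ D}

open Classical in
lemma card_threeColorings_le_prod : #(threeColorings P A) ≤ ∏ x ∈ A, #(P x) := by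
  refine card_le_prod_of_determined subset_rfl (fun c hc ↦ (mem_filter.1 hc).2.2.1) ?_
  exact fun c _ c' _ h ↦ funext fun x ↦ h x x.2

-- If `x` gets a color outside `D`, two elements of `Y` in progression with `x` must agree. So the
-- colors on `Z` are determined by the rest, which saves `2 ^ s`; the factor `n` chooses `x`.
open Classical in
lemma card_threeColorings_le_of_pair (hr : 0 < r) (hA : A ⊆ Icc 1 n) {Y : Finset ℕ} (hYA : Y ⊆ A)
    {D : Finset (Fin r)} (hD : #D = 2) (hYD : ∀ y ∈ Y, P y = D) (hg : #{x ∈ A | 3 ≤ #(P x)} ≤ g)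
    {s : ℕ} (hs : 8 * s + 16 * #(Icc 1 n \ Y) + 16 ≤ n) :
    #(threeColorings P A) ≤ n * (r ^ g * 2 ^ (n - s)) := by
  have hcover : threeColorings P A ⊆
      univ.biUnion fun x : A ↦ {c ∈ threeColorings P A | c x ∉ D} := by
    intro c hc
    have := (mem_filter.1 hc).2.2.2
    push Not at this
    obtain ⟨x, hx⟩ := this D hD
    exact mem_biUnion.2 ⟨x, mem_univ _, mem_filter.2 ⟨hc, hx⟩⟩
  have hAn : #A ≤ n := by simpa using card_le_card hA
  refine (card_le_card hcover).trans ((card_biUnion_le_card_mul _ _ (r ^ g * 2 ^ (n - s))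
    fun x _ ↦ ?_).trans (Nat.mul_le_mul_right _ (by simpa using hAn)))
  obtain ⟨Z, hZY, hZ, hmatch⟩ := exists_formAP_matching (Y := Y) (hA x.2)
  refine (card_le_prod_of_determined (P := P) (W := A \ Z) sdiff_subset
    (fun c hc ↦ (mem_filter.1 (mem_filter.1 hc).1).2.2.1) ?_).trans
      ((prod_card_le _).trans (Nat.mul_le_mul ?_ ?_))
  · have key : ∀ c ∈ threeColorings P A, c x ∉ D → ∀ y z : A, (y : ℕ) ∈ Y → (z : ℕ) ∈ Y →
        FormAP x y z → c y = c z := by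
      intro c hc hcx y z hy hz hF
      have hc' := (mem_filter.1 hc).2
      have h1 : c y ∈ D := hYD y hy ▸ hc'.2.1 y
      have h2 : c z ∈ D := hYD z hz ▸ hc'.2.1 z
      exact hc'.1.eq_of_formAP hF (fun e ↦ hcx (e ▸ h1)) (fun e ↦ hcx (e ▸ h2))
    intro c hc c' hc' h
    rw [mem_filter] at hc hc'
    funext z
    by_cases hz : (z : ℕ) ∈ Z
    · obtain ⟨y, hy, hF⟩ := hmatch z hz
      rw [mem_sdiff] at hy
      rw [← key c hc.1 hc.2 ⟨y, hYA hy.1⟩ z hy.1 (hZY hz) hF,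
        ← key c' hc'.1 hc'.2 ⟨y, hYA hy.1⟩ z hy.1 (hZY hz) hF]
      exact h _ (mem_sdiff.2 ⟨hYA hy.1, hy.2⟩)
    · exact h z (mem_sdiff.2 ⟨z.2, hz⟩)
  · exact Nat.pow_le_pow_right hr
      ((card_le_card (filter_subset_filter _ sdiff_subset)).trans hg)
  · refine Nat.pow_le_pow_right two_pos ((card_filter_le _ _).trans ?_)
    have := card_sdiff_add_card_eq_card (hZY.trans hYA)
    omega

open Classical in
/-- The number of colorings with at least three colors from lists with few conflicts. -/
lemma card_threeColorings_cases (hr : 0 < r) (hA : A ⊆ Icc 1 n)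
    (hbad : #{x ∈ A | g < #(conflicts P A x)} ≤ g) (hgn : 200 * g ≤ n) (hn : 1000 ≤ n) :
    (∃ k l, k ≤ 2 * #(Icc 1 n \ A) + 3 * g + 2 ∧
      4 * (k + l) ≤ n + 8 + 12 * #(Icc 1 n \ A) + 4 * g ∧
      #(threeColorings P A) ≤ r ^ k * 2 ^ l) ∨
    (∃ l, 100 * l ≤ 99 * n ∧ #(threeColorings P A) ≤ n * (r ^ g * 2 ^ l)) := by
  rcases (threeColorings P A).eq_empty_or_nonempty with hemp | ⟨c₀, hc₀⟩
  · right
    exact ⟨0, by omega, by simp [hemp]⟩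
  have hP : ∀ x ∈ A, (P x).Nonempty := fun x hx ↦ ⟨_, (mem_filter.1 hc₀).2.2.1 ⟨x, hx⟩⟩
  set B : Finset ℕ := {x ∈ A | g < #(conflicts P A x)} with hB
  have hprod := card_threeColorings_le_prod (P := P) (A := A).trans (prod_card_le A)
  set X3 : Finset ℕ := {x ∈ A | 3 ≤ #(P x)} with hX3
  set X2 : Finset ℕ := {x ∈ A | #(P x) = 2} with hX2
  have hgood : ∀ x ∈ A, x ∉ B → #(conflicts P A x) ≤ g := fun x hx hxB ↦ by
    by_contra h
    exact hxB (mem_filter.2 ⟨hx, by omega⟩)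
  have hX3B : #X3 ≤ #(X3 \ B) + g := by
    have := card_sdiff_add_card X3 B
    have := card_le_card (subset_union_left : X3 ⊆ X3 ∪ B)
    omega
  have hX2B : #X2 ≤ #(X2 \ B) + g := by
    have := card_sdiff_add_card X2 B
    have := card_le_card (subset_union_left : X2 ⊆ X2 ∪ B)
    omega
  rcases (X3 \ B).eq_empty_or_nonempty with hemp | ⟨x, hx⟩
  · right
    rw [hemp, card_empty, zero_add] at hX3B
    by_cases hl : 100 * #X2 ≤ 99 * n
    · refine ⟨#X2, hl, hprod.trans ?_⟩
      calc r ^ #X3 * 2 ^ #X2 ≤ r ^ g * 2 ^ #X2 :=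
            Nat.mul_le_mul_right _ (Nat.pow_le_pow_right hr hX3B)
        _ ≤ n * (r ^ g * 2 ^ #X2) := Nat.le_mul_of_pos_left _ (by omega)
    · set Y := X2 \ B with hY
      have hYA : Y ⊆ A := sdiff_subset.trans (filter_subset _ _)
      have hYc := card_sdiff_add_card_eq_card (hYA.trans hA)
      rw [Nat.card_Icc] at hYc
      have hY2 : ∀ y ∈ Y, #(P y) = 2 := fun y hy ↦ (mem_filter.1 (mem_sdiff.1 hy).1).2
      have hYg : ∀ y ∈ Y, #(conflicts P A y) ≤ g := fun y hy ↦
        hgood y (hYA hy) (mem_sdiff.1 hy).2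
      obtain ⟨y₀, hy₀⟩ : Y.Nonempty := card_pos.1 (by omega)
      -- `Y` misses at most `3 * n / 200` points, so the matching, about `n / 8` minus twice that,
      -- has at least `n / 20` pairs.
      refine ⟨n - n / 20, by omega, card_threeColorings_le_of_pair hr hA hYA (hY2 y₀ hy₀)
        (fun y hy ↦ eq_of_card_eq_two hA hYA hY2 hYg ?_ hy₀ hy) hX3B ?_⟩
      · omega
      · omega
  · left
    obtain ⟨hx3, hxB⟩ := mem_sdiff.1 hx
    obtain ⟨hxA, hx3⟩ := mem_filter.1 hx3
    refine ⟨#X3, #X2, ?_, ?_, hprod⟩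
    · have := card_three_le_card_le (g := g) hA hP
        ((sdiff_subset : X3 \ B ⊆ X3).trans (filter_subset _ _))
        (fun x hx ↦ (mem_filter.1 (mem_sdiff.1 hx).1).2)
        (fun x hx ↦ hgood x (mem_filter.1 (mem_sdiff.1 hx).1).1 (mem_sdiff.1 hx).2)
      omega
    · have h1 := card_two_le_card_le hA hP hxA hx3 (hgood x hxA hxB)
      have h2 : #X3 + #X2 ≤ #{y ∈ A | 2 ≤ #(P y)} := by
        rw [← card_union_of_disjoint]
        · refine card_le_card fun y hy ↦ ?_
          simp only [hX3, hX2, mem_union, mem_filter] at hy ⊢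
          exact ⟨by tauto, by omega⟩
        · rw [disjoint_filter]
          intros
          omega
      omega

lemma pow_mul_two_pow_le (hr : 0 < r) {k l : ℕ} {E : ℝ} (h : Real.logb 2 r * k + l ≤ E) :
    (r : ℝ) ^ k * 2 ^ l ≤ 2 ^ E := by
  have hr' : (0 : ℝ) < r := by exact_mod_cast hr
  have h1 : (r : ℝ) ^ k = 2 ^ (Real.logb 2 r * k) := by
    rw [Real.rpow_mul two_pos.le, Real.rpow_logb two_pos (by norm_num) hr', Real.rpow_natCast]
  rw [h1, ← Real.rpow_natCast 2 l, ← Real.rpow_add two_pos]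
  exact Real.rpow_le_rpow_of_exponent_le one_le_two h

open Filter in
lemma eventually_natCast_le_two_rpow {a : ℝ} (ha : 0 < a) :
    ∀ᶠ n : ℕ in atTop, (n : ℝ) ≤ 2 ^ (a * n) := by
  have h1 : (1 : ℝ) < 2 ^ a := Real.one_lt_rpow one_lt_two ha
  have h2 := tendsto_pow_const_div_const_pow_of_one_lt 1 h1
  filter_upwards [h2.eventually (gt_mem_nhds one_pos)] with n hn
  rw [pow_one, div_lt_one (by positivity)] at hn
  rw [Real.rpow_mul_natCast two_pos.le]
  exact hn.le

open Filter Classical in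
/-- There are exponentially fewer than `2 ^ n` colorings with at least three colors from lists with
few conflicts. -/
lemma exists_card_threeColorings_le (r : ℕ) (hr : 3 ≤ r) {ξ : ℝ} (hξ0 : 0 < ξ)
    (hξ : ξ = 3 / (5 + 8 * Real.logb 2 (r : ℝ))) :
    ∃ γ β : ℝ, 0 < γ ∧ 0 < β ∧ ∀ᶠ n : ℕ in atTop, ∀ A : Finset ℕ, A ⊆ Icc 1 n →
      (1 - ξ) * (n : ℝ) ≤ #A → ∀ P : ℕ → Finset (Fin r),
        (#{x ∈ A | γ * n < #(conflicts P A x)} : ℝ) ≤ γ * n →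
          (#(threeColorings P A) : ℝ) ≤ 2 ^ ((1 - β) * n) := by
  set L := Real.logb 2 (r : ℝ) with hL
  have hL1 : 1 ≤ L := by
    rw [hL, Real.le_logb_iff_rpow_le one_lt_two (by positivity), Real.rpow_one]
    exact_mod_cast (by omega : 2 ≤ r)
  have hξL : ξ * (5 + 8 * L) = 3 := by
    rw [hξ]
    field_simp
  have hξ1 : ξ ≤ 3 / 13 := by
    nlinarith
  set γ := ξ / (48 * L) with hγ
  have hγL : γ * L = ξ / 48 := by
    rw [hγ]
    field_simp
  have hγ0 : 0 < γ := by positivity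
  have hγ1 : γ ≤ ξ / 48 := by nlinarith
  refine ⟨γ, ξ / 1000, hγ0, by positivity, ?_⟩
  filter_upwards [eventually_ge_atTop 1000, eventually_ge_atTop ⌈32 * L / ξ⌉₊,
    eventually_natCast_le_two_rpow (a := 1 / 500) (by norm_num)] with n hn1 hn2 hn3 A hA hAξ P hbad
  have hn2' : 32 * L ≤ ξ * n := by
    have := Nat.ceil_le.1 hn2
    rwa [div_le_iff₀' hξ0] at this
  have hn0 : (0 : ℝ) ≤ n := Nat.cast_nonneg n
  set g := ⌊γ * n⌋₊ with hg
  have hgn : (g : ℝ) ≤ γ * n := Nat.floor_le (by positivity)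
  have hgL : L * g ≤ ξ / 48 * n := by
    calc L * g ≤ L * (γ * n) := by gcongr
      _ = (γ * L) * n := by ring
      _ = _ := by rw [hγL]
  have hbad' : #{x ∈ A | g < #(conflicts P A x)} ≤ g := by
    refine Nat.le_floor (le_trans ?_ hbad)
    refine Nat.cast_le.2 (card_le_card fun x hx ↦ ?_)
    rw [mem_filter] at hx ⊢
    exact ⟨hx.1, Nat.lt_of_floor_lt hx.2⟩
  have hm : (#(Icc 1 n \ A) : ℝ) ≤ ξ * n := by
    have h1 := card_sdiff_add_card_eq_card hA
    rw [Nat.card_Icc, Nat.add_sub_cancel] at h1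
    have h2 : (#(Icc 1 n \ A) : ℝ) + #A = n := by exact_mod_cast h1
    linarith
  have hgn' : 200 * g ≤ n := by
    have : 200 * (g : ℝ) ≤ n := by nlinarith
    exact_mod_cast this
  rcases card_threeColorings_cases (by omega) hA hbad' hgn' hn1 with
    ⟨k, l, hk, hkl, hcard⟩ | ⟨l, hl, hcard⟩
  · have hcard' : (#(threeColorings P A) : ℝ) ≤ r ^ k * 2 ^ l := by exact_mod_cast hcard
    refine hcard'.trans (pow_mul_two_pow_le (by omega) ?_)
    have hk' : (k : ℝ) ≤ 2 * #(Icc 1 n \ A) + 3 * g + 2 := by exact_mod_cast hk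
    have hkl' : 4 * ((k : ℝ) + l) ≤ n + 8 + 12 * #(Icc 1 n \ A) + 4 * g := by exact_mod_cast hkl
    -- Write `L * k + l = (L - 1) * k + (k + l)`. The main terms are `n / 4 + (2 * L + 1) * ξ * n`,
    -- which `hξL` turns into `(1 - ξ / 4) * n`; the slack absorbs the terms in `g` and the
    -- constants.
    have h1 : (L - 1) * k ≤ (L - 1) * (2 * (ξ * n) + 3 * g + 2) := by
      refine mul_le_mul_of_nonneg_left ?_ (by linarith)
      linarith
    have h2 : L * (ξ * n) = (3 - 5 * ξ) / 8 * n := by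
      have : L * ξ = (3 - 5 * ξ) / 8 := by linarith
      rw [← mul_assoc, this]
    have h3 : (0 : ℝ) ≤ g := Nat.cast_nonneg g
    rw [← hL]
    nlinarith
  · have hcard' : (#(threeColorings P A) : ℝ) ≤ n * (r ^ g * 2 ^ l) := by exact_mod_cast hcard
    have hl' : 100 * (l : ℝ) ≤ 99 * n := by exact_mod_cast hl
    refine hcard'.trans ?_
    refine (mul_le_mul hn3 (pow_mul_two_pow_le (E := 199 / 200 * n) (by omega) ?_)
      (by positivity) (by positivity)).trans ?_
    · rw [← hL]
      nlinarith
    · rw [← Real.rpow_add two_pos]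
      refine Real.rpow_le_rpow_of_exponent_le one_le_two ?_
      nlinarith

/-! ### Rainbow triples as a sparse triple system, and the final count. -/

/-- The triples of colored elements of `A` that form a rainbow progression. -/
def RainbowTriple (r : ℕ) (A : Finset ℕ) (u v w : A × Fin r) : Prop :=
  FormAP u.1 v.1 w.1 ∧ u.2 ≠ v.2 ∧ u.2 ≠ w.2 ∧ v.2 ≠ w.2

lemma isSparseTriple_rainbowTriple (r : ℕ) (A : Finset ℕ) :
    IsSparseTriple (RainbowTriple r A) (3 * r) where
  swap_left := by
    rintro x y z ⟨⟨h1, h2⟩, h3, h4, h5⟩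
    exact ⟨⟨h1.symm, by omega⟩, h3.symm, h5, h4⟩
  swap_right := by
    rintro x y z ⟨⟨h1, h2⟩, h3, h4, h5⟩
    exact ⟨⟨by omega, by omega⟩, h4, h3, h5.symm⟩
  codegree := by
    classical
    intro x y
    set s : Finset ℕ := {2 * (y.1 : ℕ) - x.1, ((x.1 : ℕ) + y.1) / 2, 2 * (x.1 : ℕ) - y.1} with hs
    have hs3 : #s ≤ 3 := card_le_three
    rw [Nat.card_eq_fintype_card, Fintype.card_subtype]
    calc _ ≤ #(s ×ˢ (univ : Finset (Fin r))) := by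
          refine card_le_card_of_injOn (fun z ↦ ((z.1 : ℕ), z.2)) (fun z hz ↦ ?_) ?_
          · obtain ⟨⟨-, h⟩, -⟩ := (mem_filter.1 hz).2
            simp only [coe_product, Set.mem_prod, mem_coe, mem_univ, and_true, hs, mem_insert,
              mem_singleton]
            omega
          · intro z _ z' _ h
            simp only [Prod.mk.injEq] at h
            exact Prod.ext (Subtype.ext h.1) h.2
      _ ≤ 3 * r := by
          rw [card_product, card_univ, Fintype.card_fin]
          gcongr

open Classical in
/-- The colors that `C` allows at `x`. -/
noncomputable def lists {r : ℕ} {A : Finset ℕ} (C : Finset (A × Fin r)) (x : ℕ) : Finset (Fin r) :=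
  {i | ∃ h : x ∈ A, (⟨x, h⟩, i) ∈ C}

-- Each conflict of `x` is witnessed in the link of some `(x, i)`. With at most `r` colors, more
-- than `r * t` conflicts make one of these links heavy.
open Classical in
lemma exists_heavy_of_conflicts {t : ℝ} (ht : 0 ≤ t) (C : Finset (A × Fin r)) {x : ℕ} (hx : x ∈ A)
    (h : r * t < #(conflicts (lists C) A x)) :
    ∃ i, (⟨x, hx⟩, i) ∈ heavy (RainbowTriple r A) t C := by
  by_contra! hlight
  have hsub : conflicts (lists C) A x ⊆ (lists C x).biUnion fun i ↦
      ({p ∈ C ×ˢ C | RainbowTriple r A (⟨x, hx⟩, i) p.1 p.2}).image fun p ↦ (p.1.1 : ℕ) := by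
    intro y hy
    obtain ⟨hyA, z, hz, hF, i, hi, j, hj, k, hk, hne⟩ := mem_filter.1 hy
    obtain ⟨_, hj⟩ := (mem_filter.1 hj).2
    obtain ⟨_, hk⟩ := (mem_filter.1 hk).2
    exact mem_biUnion.2 ⟨i, hi, mem_image.2 ⟨((⟨y, hyA⟩, j), (⟨z, hz⟩, k)),
      mem_filter.2 ⟨mem_product.2 ⟨hj, hk⟩, hF, hne⟩, rfl⟩⟩
  have h1 := (card_le_card hsub).trans
    (card_biUnion_le.trans (sum_le_sum fun i _ ↦ card_image_le))
  have h2 : (#(conflicts (lists C) A x) : ℝ) ≤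
      ∑ i ∈ lists C x, (linkDegree (RainbowTriple r A) C (⟨x, hx⟩, i) : ℝ) := by
    exact_mod_cast h1
  have h3 : ∀ i ∈ lists C x, (linkDegree (RainbowTriple r A) C (⟨x, hx⟩, i) : ℝ) ≤ t := by
    intro i hi
    by_contra! hlt
    obtain ⟨_, hi⟩ := (mem_filter.1 hi).2
    exact hlight i (mem_filter.2 ⟨hi, hlt.le⟩)
  have h4 := sum_le_card_nsmul _ _ _ h3
  rw [nsmul_eq_mul] at h4
  have h5 : (#(lists C x) : ℝ) ≤ r := by exact_mod_cast card_finset_fin_le _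
  have h6 : (#(lists C x) : ℝ) * t ≤ r * t := by gcongr
  linarith

open Classical in
lemma card_conflicts_le_of_heavy {t : ℝ} (ht : 0 ≤ t) (C : Finset (A × Fin r)) {s : ℝ}
    (hs : r * t ≤ s) :
    #{x ∈ A | s < #(conflicts (lists C) A x)} ≤ #(heavy (RainbowTriple r A) t C) := by
  refine (card_le_card fun x hx ↦ ?_).trans
    (card_image_le (f := fun p : A × Fin r ↦ (p.1 : ℕ)))
  obtain ⟨hxA, hx⟩ := mem_filter.1 hx
  obtain ⟨i, hi⟩ := exists_heavy_of_conflicts ht C hxA (lt_of_le_of_lt hs hx)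
  exact mem_image.2 ⟨_, hi, rfl⟩

open Filter Classical in
/-- There are exponentially fewer than `2 ^ n` rainbow-free colorings with at least three colors. -/
lemma exists_card_three_colors_le (r : ℕ) (hr : 3 ≤ r) {ξ : ℝ} (hξ0 : 0 < ξ)
    (hξ : ξ = 3 / (5 + 8 * Real.logb 2 (r : ℝ))) :
    ∃ β : ℝ, 0 < β ∧ ∀ᶠ n : ℕ in atTop, ∀ A : Finset ℕ, A ⊆ Icc 1 n →
      (1 - ξ) * (n : ℝ) ≤ #A →
        (#{c : A → Fin r | RainbowThreeAPFree c ∧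
          ¬ ∃ D : Finset (Fin r), #D = 2 ∧ ∀ x, c x ∈ D} : ℝ) ≤ 2 ^ ((1 - β) * n) := by
  obtain ⟨γ, β, hγ, hβ, hlists⟩ := exists_card_threeColorings_le r hr hξ0 hξ
  have hr0 : (0 : ℝ) < r := by positivity
  -- On `r * #A` points this gives `t = γ * #A / r`, which offsets the factor `r` between heaviness
  -- and conflicts. The number of containers uses up only half of the gain `β`.
  obtain ⟨N₀, hN₀⟩ := exists_containers (3 * r) (by omega) (γ := γ / r ^ 2) (ε := β / (2 * r))
    (by positivity) (by positivity)
  refine ⟨β / 2, by positivity, ?_⟩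
  filter_upwards [hlists, eventually_ge_atTop N₀] with n hn hnN A hA hAξ
  have hn0 : (0 : ℝ) ≤ n := Nat.cast_nonneg n
  have hcard : Fintype.card (A × Fin r) = #A * r := by simp
  have hAn : (#A : ℝ) ≤ n := by
    have := card_le_card hA
    rw [Nat.card_Icc, Nat.add_sub_cancel] at this
    exact_mod_cast this
  have hr3 : (3 : ℝ) ≤ r := by exact_mod_cast hr
  have hξ1 : ξ ≤ 3 / 5 := by
    have : 0 ≤ Real.logb 2 (r : ℝ) := Real.logb_nonneg one_lt_two (by linarith)
    rw [hξ]
    gcongr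
    linarith
  have hNn : N₀ ≤ Fintype.card (A × Fin r) := by
    refine hnN.trans ?_
    have : (n : ℝ) ≤ #A * r := by nlinarith
    rw [hcard]
    exact_mod_cast this
  obtain ⟨F, hF, hcover⟩ := hN₀ (A × Fin r) _ (isSparseTriple_rainbowTriple r A) hNn
  have hcardR : (Fintype.card (A × Fin r) : ℝ) = #A * r := by exact_mod_cast hcard
  rw [hcardR] at hF hcover
  set t : ℝ := γ / r ^ 2 * (#A * r) with ht
  have ht0 : 0 ≤ t := by positivity
  have hrt : r * t ≤ γ * n := by
    have : r * t = γ * #A := by rw [ht]; field_simp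
    rw [this]
    gcongr
  have htn : t ≤ γ * n := by nlinarith
  have hsub : ({c : A → Fin r | RainbowThreeAPFree c ∧
      ¬ ∃ D : Finset (Fin r), #D = 2 ∧ ∀ x, c x ∈ D} : Finset (A → Fin r)) ⊆
      {C ∈ F | (#(heavy (RainbowTriple r A) t C) : ℝ) < t}.biUnion
        fun C ↦ threeColorings (lists C) A := by
    intro c hc
    obtain ⟨hfree, hthree⟩ := (mem_filter.1 hc).2
    obtain ⟨C, hC, hIC, hheavy⟩ := hcover (univ.image fun x ↦ (x, c x)) (by
      intro u hu v hv w hw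
      obtain ⟨x, -, rfl⟩ := mem_image.1 hu
      obtain ⟨y, -, rfl⟩ := mem_image.1 hv
      obtain ⟨z, -, rfl⟩ := mem_image.1 hw
      rintro ⟨hF, h1, h2, h3⟩
      exact h3 (hfree.eq_of_formAP hF h1 h2))
    refine mem_biUnion.2 ⟨C, mem_filter.2 ⟨hC, hheavy⟩, mem_filter.2
      ⟨mem_univ _, hfree, fun x ↦ ?_, hthree⟩⟩
    exact mem_filter.2 ⟨mem_univ _, x.2, hIC (mem_image.2 ⟨x, mem_univ _, rfl⟩)⟩
  have h1 : (#{c : A → Fin r | RainbowThreeAPFree c ∧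
      ¬ ∃ D : Finset (Fin r), #D = 2 ∧ ∀ x, c x ∈ D} : ℝ) ≤
      ∑ C ∈ F with (#(heavy (RainbowTriple r A) t C) : ℝ) < t,
        (#(threeColorings (lists C) A) : ℝ) := by
    exact_mod_cast (card_le_card hsub).trans card_biUnion_le
  refine h1.trans ((sum_le_card_nsmul _ _ (2 ^ ((1 - β) * n)) fun C hC ↦ hn A hA hAξ _ ?_).trans ?_)
  · refine le_trans ?_ ((mem_filter.1 hC).2.le.trans htn)
    exact Nat.cast_le.2 (card_conflicts_le_of_heavy ht0 C hrt)
  · rw [nsmul_eq_mul]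
    have h2 : (#{C ∈ F | (#(heavy (RainbowTriple r A) t C) : ℝ) < t} : ℝ) ≤ #F :=
      Nat.cast_le.2 (card_filter_le _ _)
    refine (mul_le_mul_of_nonneg_right (h2.trans hF) (by positivity)).trans ?_
    rw [← Real.rpow_add two_pos]
    refine Real.rpow_le_rpow_of_exponent_le one_le_two ?_
    have : β / (2 * r) * (#A * r) = β / 2 * #A := by field_simp
    rw [this]
    nlinarith

open Classical in
/-- All but the colorings with at least three colors use only two colors. -/
lemma rainbowFreeCount_le (r : ℕ) (A : Finset ℕ) :
    rainbowFreeCount r A ≤ r.choose 2 * 2 ^ #A +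
      #{c : A → Fin r | RainbowThreeAPFree c ∧
        ¬ ∃ D : Finset (Fin r), #D = 2 ∧ ∀ x, c x ∈ D} := by
  have hsub : ({c : A → Fin r | RainbowThreeAPFree c} : Finset (A → Fin r)) ⊆
      ((powersetCard 2 univ).biUnion fun D : Finset (Fin r) ↦ Fintype.piFinset fun _ : A ↦ D) ∪
        ({c : A → Fin r | RainbowThreeAPFree c ∧
          ¬ ∃ D : Finset (Fin r), #D = 2 ∧ ∀ x, c x ∈ D} : Finset (A → Fin r)) := by
    intro c hc
    by_cases h : ∃ D : Finset (Fin r), #D = 2 ∧ ∀ x, c x ∈ D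
    · obtain ⟨D, hD, hcD⟩ := h
      exact mem_union_left _ (mem_biUnion.2
        ⟨D, mem_powersetCard.2 ⟨subset_univ _, hD⟩, Fintype.mem_piFinset.2 hcD⟩)
    · exact mem_union_right _ (mem_filter.2 ⟨mem_univ _, (mem_filter.1 hc).2, h⟩)
  rw [rainbowFreeCount, Nat.card_eq_fintype_card, Fintype.card_subtype]
  refine (card_le_card hsub).trans ((card_union_le _ _).trans (Nat.add_le_add_right ?_ _))
  refine (card_biUnion_le_card_mul _ _ (2 ^ #A) fun D hD ↦ ?_).trans_eq ?_
  · rw [Fintype.card_piFinset]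
    simp [(mem_powersetCard.1 hD).2]
  · simp

end Counting

open Filter in
theorem mainTheorem1 (r : ℕ) (hr : 3 ≤ r) (ξ : ℝ) (hξ0 : 0 < ξ)
    (hξ : ξ ≤ 3 / (5 + 8 * Real.logb 2 (r : ℝ))) :
    ∃ n₀ : ℕ, ∀ n : ℕ, n₀ ≤ n → ∀ A : Finset ℕ, A ⊆ Finset.Icc 1 n →
      (1 - ξ) * (n : ℝ) ≤ (A.card : ℝ) →
      (rainbowFreeCount r A : ℝ) ≤
        (r.choose 2 : ℝ) * (2 : ℝ) ^ A.card +
          (2 : ℝ) ^ (-((n : ℝ) / (36 * Real.logb 2 (n : ℝ)))) * (2 : ℝ) ^ n := by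
  classical
  -- The largest admissible `ξ` gives the weakest density condition, so it covers all smaller
  -- values.
  obtain ⟨β, hβ, hcount⟩ := exists_card_three_colors_le r hr (hξ0.trans_le hξ) rfl
  have hlog : ∀ᶠ n : ℕ in atTop, 1 / (36 * β) ≤ Real.logb 2 (n : ℝ) :=
    ((Real.tendsto_logb_atTop one_lt_two).comp tendsto_natCast_atTop_atTop).eventually_ge_atTop _
  obtain ⟨n₀, hn₀⟩ := eventually_atTop.1 (hcount.and hlog)
  refine ⟨n₀, fun n hn A hA hAξ ↦ ?_⟩
  obtain ⟨h1, h2⟩ := hn₀ n hn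
  have h3 := h1 A hA (le_trans (by gcongr) hAξ)
  have h4 : (rainbowFreeCount r A : ℝ) ≤ r.choose 2 * 2 ^ #A +
      #{c : A → Fin r | RainbowThreeAPFree c ∧
        ¬ ∃ D : Finset (Fin r), #D = 2 ∧ ∀ x, c x ∈ D} := by
    exact_mod_cast rainbowFreeCount_le r A
  refine h4.trans (add_le_add_right (h3.trans ?_) _)
  rw [← Real.rpow_natCast 2 n, ← Real.rpow_add two_pos]
  refine Real.rpow_le_rpow_of_exponent_le one_le_two ?_
  have hl : 0 < Real.logb 2 (n : ℝ) := lt_of_lt_of_le (by positivity) h2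
  rw [div_le_iff₀ (by positivity)] at h2
  have : (n : ℝ) / (36 * Real.logb 2 (n : ℝ)) ≤ β * n := by
    rw [div_le_iff₀ (by positivity)]
    nlinarith [(Nat.cast_nonneg n : (0 : ℝ) ≤ n)]
  linarith
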